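/- Let $\mathcal X=\{0,1\}$, $K\ge 3$, and let $d:\mathcal X\times\mathcal X\to\mathbb R_{\ge 0}$ be any function (a distortion measure), extended to strings by $d(c^n,x^n)=\frac1n\sum_{i} d(c_i,x_i)$. For a string $x^n\in\mathcal X^n$ let $\overline N(\cdot|x^n)$ be its type (empirical distribution). For channels $\mathbf W=(W_1,\dots,W_K)$ on $\mathcal X$ let $\mathbb P(\mathbf y|x^n)=\prod_{i=1}^n\prod_{j=1}^K w_j(y_{ij}|x_i)$ be the law of the $K$ noisy copies of $x^n$, and let $w(y|x)=\prod_{j=1}^K w_j(y_j|x)$ for $y\in\mathcal X^K$. Below, $\tau$ ranges over the permutations of $\mathcal X$, $p$ over the probability distributions on $\mathcal X$, and a sequence of algorithms is a sequence $\mathcal C=(C_n)$ of maps $C_n:(\mathcal X^K)^n\to\mathcal X^n$. Say that $N\in\mathbb N$ is *good* for $(\mathcal C,\mathbf W,p,D,\varepsilon)$ if for all $n\ge N$ and all $x^n\in\mathcal X^n$ with $\|\overline N(\cdot|x^n)-p\|_1\le \frac1{N+1}$, $$\mathbb P\Bigl(\min_\tau d\bigl(C_n(\mathbf y),\tau^{\otimes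 n}(x^n)\bigr)>D\Bigr)<\varepsilon .$$ The sequence $\mathcal C$ achieves resolution $D$ on $\mathbf W$ with respect to $p$ if for every $\varepsilon>0$ there is a good $N=N(p,\mathbf W,\varepsilon)$; it uniformly achieves a function $p\mapsto D(p)\ge 0$ on $\mathbf W$ if for every $\varepsilon>0$ there is one $N=N(\mathbf W,\varepsilon)$ that is good for $(\mathcal C,\mathbf W,p,D(p),\varepsilon)$ for all $p$. The resolution $\mathcal R(p,\mathbf W)$ is the infimum of all $D\ge0$ achieved by some $\mathcal C$ on $\mathbf W$ with respect to $p$, and the uniform resolution $\overline{\mathcal R}(p,\mathbf W)$ is the infimum of the values $D(p)$ over all functions $D(\cdot)\geq 0$ that are uniformly achieved on $\mathbf W$ by some $\mathcal C$. For a set $\mathcal S$ of channels, $\mathcal C$ is uniformly universal on $\mathcal S$ if for all $\mathbf W\in\mathcal S^K$ and all $\delta>0$ it uniformly achieves $p\mapsto\mathcal R(p,\mathbf W)+\delta$ on $\mathbf W$ (the same $\mathcal C$ for all $\mathbf W$, $p$, $\delta$). The minimal clairvoyant ambiguous distortion is $$d_{\mathrm{MCA}}(p,\mathbf W)=\min_{\tau,\mathcal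 T}\ \sum_{x,x'\in\mathcal X}p(x)\,d(x',\tau(x))\,w(T_{x'}|x),$$ where $\mathcal T=\{T_x\}_{x\in\mathcal X}$ ranges over the partitions of $\mathcal X^K$ indexed by $\mathcal X$ (parts may be empty). Theorem. Let $\mathcal S$ be the set of binary symmetric channels $B$ with $b(0|0)\ne\frac12$. For all $\mathbf B\in\mathcal S^K$ and all $p$, $$\overline{\mathcal R}(p,\mathbf B)=d_{\mathrm{MCA}}(p,\mathbf B).$$ If moreover $d(\sigma(x),\sigma(y))=d(x,y)$ for all permutations $\sigma$ of $\mathcal X$ and all $x,y$ (for instance, if $d$ is the Hamming metric), then also $$\overline{\mathcal R}(p,\mathbf B)=\min_{\tau,\mathcal T}\ \sum_{x,x'}p(x)\,d(x,x')\,w(T_{\tau(x')}|x),\qquad w(y|x)=\prod_{j=1}^K b_j(y_j|x).$$ There is a sequence of algorithms that is uniformly universal on $\mathcal S$. -/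

import Mathlib

/-! Universal discrete denoising from `K` noisy copies of a string over a finite alphabet.
Probability distributions on a finite set are the points of `stdSimplex`; a channel `w` is a
stochastic matrix, `w x y` being the probability of output `y` given input `x`. -/

namespace Denoising

noncomputable section

/-- `w` is a channel (stochastic matrix): every row is a probability distribution. -/
def IsChannel {X Y : Type} [Fintype Y] (w : X → Y → ℝ) : Prop :=
  ∀ x, w x ∈ stdSimplex ℝ Y

/-- The binary symmetric channels `B` with `B(0|0) ≠ 1/2`. -/
def invertibleBSC : Set (Fin 2 → Fin 2 → ℝ) :=
  {B | IsChannel B ∧ B 0 0 = B 1 1 ∧ B 0 1 = B 1 0 ∧ B 0 0 ≠ 1 / 2}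

/-- The channel from `X` to `X ^ K` that feeds the same input into `W 0, …, W (K - 1)`, which act
independently: the parallel channel composed with the diagonal. -/
def jointChannel {X : Type} {K : ℕ} (W : Fin K → X → X → ℝ) : X → (Fin K → X) → ℝ :=
  fun x y => ∏ j, W j x (y j)

/-- The probability of receiving the `n × K` matrix `y` when the original string is `x`. -/
def law {X : Type} {K n : ℕ} (W : Fin K → X → X → ℝ) (x : Fin n → X)
    (y : Fin n → Fin K → X) : ℝ :=
  ∏ i, jointChannel W (x i) (y i)

/-- The type (empirical distribution) of a string. -/
def empType {X : Type} [DecidableEq X] {n : ℕ} (x : Fin n → X) : X → ℝ :=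
  fun a => ((Finset.univ.filter fun i => x i = a).card : ℝ) / n

/-- The extension of a distortion measure to strings, by averaging. -/
def strDistortion {X : Type} {n : ℕ} (d : X → X → ℝ) (x y : Fin n → X) : ℝ :=
  (1 / (n : ℝ)) * ∑ i, d (x i) (y i)

/-- The distortion of the estimate `c` of the string `x`, up to a permutation of the letters of
`x`: the minimum over permutations `τ` of the distortion between `c` and `τ x`. -/
def ambDistortion {X : Type} {n : ℕ} (d : X → X → ℝ) (c x : Fin n → X) : ℝ :=
  ⨅ τ : Equiv.Perm X, strDistortion d c (fun i => τ (x i))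

/-- A sequence of algorithms `C n : (X ^ K) ^ n → X ^ n`. -/
abbrev Algorithms (X : Type) (K : ℕ) : Type :=
  (n : ℕ) → (Fin n → Fin K → X) → (Fin n → X)

/-- The probability, given the original `x`, that the output of the algorithm has a distortion
greater than `D` from `x`, up to a permutation of the letters. -/
def failProb {X : Type} [Fintype X] {K n : ℕ} (d : X → X → ℝ) (W : Fin K → X → X → ℝ)
    (C : Algorithms X K) (D : ℝ) (x : Fin n → X) : ℝ :=
  ∑ y : Fin n → Fin K → X with D < ambDistortion d (C n y) x, law W x y

/-- From the length `N` on, all strings of type close to `p` (at most `1 / (N + 1)` away in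
the 1-norm) are recovered within distortion `D`, up to a probability smaller than `ε`. -/
def SucceedsFrom {X : Type} [Fintype X] [DecidableEq X] {K : ℕ} (d : X → X → ℝ)
    (W : Fin K → X → X → ℝ) (C : Algorithms X K) (p : X → ℝ) (D ε : ℝ) (N : ℕ) : Prop :=
  ∀ n ≥ N, ∀ x : Fin n → X, ∑ a, |empType x a - p a| ≤ 1 / ((N : ℝ) + 1) →
    failProb d W C D x < ε

/-- `C` achieves resolution `D` on `W` with respect to `p`; here `N` may depend on `p`. -/
def Achieves {X : Type} [Fintype X] [DecidableEq X] {K : ℕ} (d : X → X → ℝ)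
    (W : Fin K → X → X → ℝ) (C : Algorithms X K) (p : X → ℝ) (D : ℝ) : Prop :=
  ∀ ε > 0, ∃ N : ℕ, SucceedsFrom d W C p D ε N

/-- `C` uniformly achieves on `W` the resolution `D p` with respect to every distribution `p`:
the number `N` is independent of `p`. -/
def UniformlyAchieves {X : Type} [Fintype X] [DecidableEq X] {K : ℕ} (d : X → X → ℝ)
    (W : Fin K → X → X → ℝ) (C : Algorithms X K) (D : (X → ℝ) → ℝ) : Prop :=
  ∀ ε > 0, ∃ N : ℕ, ∀ p ∈ stdSimplex ℝ X, SucceedsFrom d W C p (D p) ε N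

/-- The resolution of `W` with respect to `p`. -/
def resolution {X : Type} [Fintype X] [DecidableEq X] {K : ℕ} (d : X → X → ℝ) (p : X → ℝ)
    (W : Fin K → X → X → ℝ) : ℝ :=
  sInf {D : ℝ | 0 ≤ D ∧ ∃ C : Algorithms X K, Achieves d W C p D}

/-- The uniform resolution of `W` with respect to `p`. -/
def uniformResolution {X : Type} [Fintype X] [DecidableEq X] {K : ℕ} (d : X → X → ℝ) (p : X → ℝ)
    (W : Fin K → X → X → ℝ) : ℝ :=
  sInf {r : ℝ | ∃ (C : Algorithms X K) (D : (X → ℝ) → ℝ),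
    (∀ p' ∈ stdSimplex ℝ X, 0 ≤ D p') ∧ UniformlyAchieves d W C D ∧ D p = r}

/-- `C` is uniformly universal on the class `S` of channels: it attains the resolution (to within
every positive `δ`) of all `W` in `S ^ K` with respect to all `p`, and for each `W` it does so
uniformly in `p`. The algorithms in `C` know neither `W` nor `p`. -/
def UniformlyUniversal {X : Type} [Fintype X] [DecidableEq X] {K : ℕ} (d : X → X → ℝ)
    (S : Set (X → X → ℝ)) (C : Algorithms X K) : Prop :=
  ∀ W : Fin K → X → X → ℝ, (∀ j, W j ∈ S) → ∀ δ > 0,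
    UniformlyAchieves d W C (fun p => resolution d p W + δ)

/-- `w (T_a | x)` for the partition `T_a = {y | g y = a}`, `a ∈ X`, of `Y`. Partitions of `Y`
indexed by `X` (with empty parts allowed) are the same thing as maps `g : Y → X`. -/
def cellProb {X Y : Type} [DecidableEq X] [Fintype Y] (w : X → Y → ℝ) (g : Y → X) (a x : X) : ℝ :=
  ∑ y with g y = a, w x y

/-- The minimal clairvoyant ambiguous distortion: the least expected distortion, up to a
permutation `τ` of the letters of the original, of a letter-by-letter decoder `g` that knows `p`
and `w`. As in `ambDistortion`, the estimate is the first argument of `d`, and `τ` acts on the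
original letter. -/
def mcaDistortion {X Y : Type} [Fintype X] [DecidableEq X] [Fintype Y] (d : X → X → ℝ)
    (p : X → ℝ) (w : X → Y → ℝ) : ℝ :=
  ⨅ (s : Equiv.Perm X × (Y → X)), ∑ x, ∑ x', p x * d x' (s.1 x) * cellProb w s.2 x' x

/-- The variant of the minimal clairvoyant ambiguous distortion in which the original is the first
argument of `d` and the permutation acts on the labels of the parts of the partition. -/
def mcaDistortion' {X Y : Type} [Fintype X] [DecidableEq X] [Fintype Y] (d : X → X → ℝ)
    (p : X → ℝ) (w : X → Y → ℝ) : ℝ :=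
  ⨅ (s : Equiv.Perm X × (Y → X)), ∑ x, ∑ x', p x * d x x' * cellProb w s.2 (s.1 x') x

end

end Denoising

open Denoising

/-! Both resolutions equal the minimal clairvoyant ambiguous distortion, because it is a lower bound
for every algorithm and because one universal algorithm attains it uniformly.

Lower bound (`mcaDistortion_le_of_achieves`). Sample the original independently from `p`. Given the
received string, the original letters are independent, with conditional distributions that depend
only on the letter received at the same position. By Chebyshev's inequality, for each relabelling
`τ` the distortion of any estimate is, up to a small error, at least its conditional expectation,
and this is at least the loss of the best letter-by-letter decoder. A union bound over the finitely
many `τ` completes the argument.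

Attainment (`exists_forall_uniformlyAchieves_mcaDistortion`). The algorithm looks at the type of the
received string, picks a pair of an input distribution and a tuple of binary symmetric channels
whose output distribution is closest to it, and applies the optimal letter-by-letter decoder for
this pair. The joint type of original and received string concentrates, uniformly in the original,
and determines the distortion of such a decoder. Since the pairs form a compact set, near-optimality
follows from identifiability alone (`exists_plugin_decoder`): a pair with the true output
distribution is the true pair up to a relabelling of the input letters, and relabelling is harmless
since the distortion is ambiguous. For `K ≥ 3` binary symmetric channels with nonzero biases,
identifiability holds because the correlations of two received bits are the pairwise products of the
biases (`exists_perm_of_outputLaw_eq`). -/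

namespace Denoising

/-! ### Laws of large numbers for product distributions -/

/-- Under a product distribution, the expectation of a product of functions of the single
coordinates is the product of their expectations. -/
theorem sum_prod_mul_prod {ι A : Type} [Fintype ι] [DecidableEq ι] [Fintype A]
    (P f : ι → A → ℝ) :
    ∑ x : ι → A, (∏ i, P i (x i)) * ∏ i, f i (x i) = ∏ i, ∑ a, P i a * f i a := by
  simp_rw [← Finset.prod_mul_distrib]
  rw [Finset.prod_univ_sum, Fintype.piFinset_univ]

theorem sum_prod_eq_one {ι A : Type} [Fintype ι] [DecidableEq ι] [Fintype A]
    {P : ι → A → ℝ} (hP : ∀ i, P i ∈ stdSimplex ℝ A) :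
    ∑ x : ι → A, ∏ i, P i (x i) = 1 := by
  have := sum_prod_mul_prod P (fun _ _ => 1)
  simp only [Finset.prod_const_one, mul_one, (hP _).2] at this
  exact this

/-- The second moment of a sum of independent centred variables is at most the sum of the bounds
on their squares: the mixed terms vanish. -/
theorem sum_prod_mul_sq_le {ι A : Type} [Fintype ι] [DecidableEq ι] [Fintype A]
    {P : ι → A → ℝ} (hP : ∀ i, P i ∈ stdSimplex ℝ A) (h : ι → A → ℝ)
    (h0 : ∀ i, ∑ a, P i a * h i a = 0) {M : ℝ} (hM : ∀ i a, |h i a| ≤ M) :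
    ∑ x : ι → A, (∏ i, P i (x i)) * (∑ i, h i (x i)) ^ 2 ≤ Fintype.card ι * M ^ 2 := by
  have key : ∀ i k, ∑ x : ι → A, (∏ j, P j (x j)) * (h i (x i) * h k (x k))
      ≤ if i = k then M ^ 2 else 0 := by
    intro i k
    split_ifs with hik
    · subst hik
      calc _ ≤ ∑ x : ι → A, (∏ j, P j (x j)) * M ^ 2 := by
            refine Finset.sum_le_sum fun x _ => mul_le_mul_of_nonneg_left ?_
              (Finset.prod_nonneg fun j _ => (hP j).1 _)
            rw [← sq]
            exact sq_le_sq' (neg_le_of_abs_le (hM _ _)) (le_of_abs_le (hM _ _))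
        _ = M ^ 2 := by rw [← Finset.sum_mul, sum_prod_eq_one hP, one_mul]
    -- `h i (x i) * h k (x k)` is a product over all coordinates, with the `i`-th factor centred.
    · have := sum_prod_mul_prod P
        (fun j a => (if j = i then h i a else 1) * (if j = k then h k a else 1))
      simp only [Finset.prod_mul_distrib, Finset.prod_ite_eq', Finset.mem_univ, if_true] at this
      rw [this]
      refine (Finset.prod_eq_zero (Finset.mem_univ i) ?_).le
      simpa [hik] using h0 i
  calc _ = ∑ i, ∑ k, ∑ x : ι → A, (∏ j, P j (x j)) * (h i (x i) * h k (x k)) := by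
        simp_rw [sq, Finset.sum_mul_sum, Finset.mul_sum]
        rw [Finset.sum_comm]
        exact Finset.sum_congr rfl fun i _ => Finset.sum_comm
    _ ≤ ∑ i, ∑ k, if i = k then M ^ 2 else 0 :=
        Finset.sum_le_sum fun i _ => Finset.sum_le_sum fun k _ => key i k
    _ = _ := by simp

/-- Chebyshev's inequality for a sum of independent bounded variables, not necessarily centred or
identically distributed. -/
theorem chebyshev_prod {ι A : Type} [Fintype ι] [DecidableEq ι] [Fintype A]
    {P : ι → A → ℝ} (hP : ∀ i, P i ∈ stdSimplex ℝ A) (h : ι → A → ℝ)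
    {M : ℝ} (hM : ∀ i a, |h i a| ≤ M) {s : ℝ} (hs : 0 < s) :
    ∑ x : ι → A with s ≤ |∑ i, h i (x i) - ∑ i, ∑ a, P i a * h i a|, ∏ i, P i (x i)
      ≤ Fintype.card ι * (2 * M) ^ 2 / s ^ 2 := by
  set e : ι → ℝ := fun i => ∑ a, P i a * h i a with he
  have hmean : ∀ i, |e i| ≤ M := by
    intro i
    calc |e i| ≤ ∑ a, |P i a * h i a| := Finset.abs_sum_le_sum_abs _ _
      _ ≤ ∑ a, P i a * M := by
          refine Finset.sum_le_sum fun a _ => ?_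
          rw [abs_mul, abs_of_nonneg ((hP i).1 a)]
          exact mul_le_mul_of_nonneg_left (hM i a) ((hP i).1 a)
      _ = M := by rw [← Finset.sum_mul, (hP i).2, one_mul]
  have hv := sum_prod_mul_sq_le hP (fun i a => h i a - e i) (M := 2 * M)
    (fun i => by
      simp only [mul_sub, Finset.sum_sub_distrib, ← Finset.sum_mul, (hP i).2, one_mul]
      exact sub_self _)
    (fun i a => by
      refine (abs_sub _ _).trans ?_
      linarith [hM i a, hmean i])
  rw [le_div_iff₀ (by positivity), Finset.sum_mul]
  refine le_trans ?_ hv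
  rw [Finset.sum_filter]
  refine Finset.sum_le_sum fun x _ => ?_
  have hx : 0 ≤ ∏ i, P i (x i) := Finset.prod_nonneg fun i _ => (hP i).1 _
  split_ifs with hc
  · refine mul_le_mul_of_nonneg_left ?_ hx
    rw [Finset.sum_sub_distrib, ← sq_abs (_ - _)]
    exact pow_le_pow_left₀ hs.le hc 2
  · positivity

/-- A weak law of large numbers that is uniform in the (independent) distributions and in the
functions bounded by `M`: these may depend on `n` and on the position. -/
theorem exists_forall_prob_deviation_lt (M : ℝ) {t ε : ℝ} (ht : 0 < t) (hε : 0 < ε) :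
    ∃ N : ℕ, ∀ n ≥ N, 0 < n ∧ ∀ (A : Type) [Fintype A] (P : Fin n → A → ℝ),
      (∀ i, P i ∈ stdSimplex ℝ A) → ∀ h : Fin n → A → ℝ, (∀ i a, |h i a| ≤ M) →
      ∑ x : Fin n → A with n * t ≤ |∑ i, h i (x i) - ∑ i, ∑ a, P i a * h i a|,
        ∏ i, P i (x i) < ε := by
  obtain ⟨N, hN⟩ := exists_nat_gt ((2 * M) ^ 2 / (t ^ 2 * ε))
  refine ⟨N + 1, fun n hn => ⟨by omega, fun A _ P hP h hM => ?_⟩⟩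
  have hn0 : (0 : ℝ) < n := by exact_mod_cast (show 0 < n by omega)
  have hNn : (N : ℝ) ≤ n := by exact_mod_cast (show N ≤ n by omega)
  refine (chebyshev_prod hP h hM (mul_pos hn0 ht)).trans_lt ?_
  rw [div_lt_iff₀ (by positivity)] at hN
  rw [Fintype.card_fin, div_lt_iff₀ (by positivity)]
  calc (n : ℝ) * (2 * M) ^ 2 < n * (N * (t ^ 2 * ε)) := by gcongr
    _ ≤ n * (n * (t ^ 2 * ε)) := by gcongr
    _ = _ := by ring

/-! ### Types, joint laws and expected losses -/

theorem jointChannel_isChannel {X : Type} [Fintype X] {K : ℕ} {W : Fin K → X → X → ℝ}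
    (hW : ∀ j, IsChannel (W j)) : IsChannel (jointChannel W) := fun x =>
  ⟨fun _ => Finset.prod_nonneg fun j _ => (hW j x).1 _,
    sum_prod_eq_one (P := fun j => W j x) fun j => hW j x⟩

theorem empType_mem_Icc {X : Type} [DecidableEq X] {n : ℕ} (x : Fin n → X) :
    empType x ∈ Set.Icc (0 : X → ℝ) 1 := by
  refine ⟨fun a => by simp only [empType]; positivity, fun a => ?_⟩
  refine div_le_one_of_le₀ ?_ (Nat.cast_nonneg _)
  simpa using (Nat.cast_le (α := ℝ)).2 (Finset.card_filter_le Finset.univ fun i => x i = a)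

/-- Averages along a string are expectations with respect to its type. -/
theorem sum_empType_mul {X : Type} [Fintype X] [DecidableEq X] {n : ℕ} (x : Fin n → X)
    (f : X → ℝ) : ∑ a, empType x a * f a = 1 / (n : ℝ) * ∑ i, f (x i) := by
  have : ∀ a, empType x a * f a = 1 / (n : ℝ) * ∑ i, if x i = a then f (x i) else 0 := by
    intro a
    simp only [empType, Finset.card_filter, Nat.cast_sum, Nat.cast_ite, Nat.cast_one, Nat.cast_zero]
    rw [div_mul_eq_mul_div, Finset.sum_mul, one_div, div_eq_inv_mul]
    congr 1
    refine Finset.sum_congr rfl fun i _ => ?_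
    split_ifs with h <;> simp [h]
  simp_rw [this]
  rw [← Finset.mul_sum, Finset.sum_comm]
  simp

theorem sum_ite_eq_mul_empType {X : Type} [DecidableEq X] {n : ℕ} (hn : 0 < n)
    (x : Fin n → X) (a : X) : ∑ i, (if x i = a then (1 : ℝ) else 0) = n * empType x a := by
  have : (n : ℝ) ≠ 0 := by positivity
  simp only [empType, Finset.card_filter, Nat.cast_sum, Nat.cast_ite, Nat.cast_one, Nat.cast_zero]
  field_simp

/-- The joint distribution of a letter with distribution `p` and its image under `w`. -/
noncomputable def jointLaw {X Y : Type} (p : X → ℝ) (w : X → Y → ℝ) : X × Y → ℝ :=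
  fun z => p z.1 * w z.1 z.2

/-- The distribution of the second component under a joint distribution. -/
def outputLaw {X Y : Type} [Fintype X] (π : X × Y → ℝ) : Y → ℝ := fun b => ∑ a, π (a, b)

/-- The expected distortion, under a joint distribution `π` of original and received letter,
between the estimate `g b` of the letter and the relabelled original `τ a`; the decoder is the
pair `s = (τ, g)`. -/
def expLoss {X Y : Type} [Fintype X] [Fintype Y] (d : X → X → ℝ) (π : X × Y → ℝ)
    (s : Equiv.Perm X × (Y → X)) : ℝ :=
  ∑ z, π z * d (s.2 z.2) (s.1 z.1)

theorem mcaDistortion_eq_iInf_expLoss {X Y : Type} [Fintype X] [DecidableEq X] [Fintype Y]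
    (d : X → X → ℝ) (p : X → ℝ) (w : X → Y → ℝ) :
    mcaDistortion d p w = ⨅ s, expLoss d (jointLaw p w) s := by
  unfold mcaDistortion expLoss jointLaw cellProb
  congr 1
  ext s
  rw [Fintype.sum_prod_type]
  refine Finset.sum_congr rfl fun x _ => ?_
  simp_rw [Finset.mul_sum, Finset.sum_filter]
  rw [Finset.sum_comm]
  refine Finset.sum_congr rfl fun y _ => ?_
  simp only [Finset.sum_ite_eq, Finset.mem_univ, if_true]
  ring

theorem mcaDistortion_le {X Y : Type} [Fintype X] [DecidableEq X] [Fintype Y]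
    (d : X → X → ℝ) (p : X → ℝ) (w : X → Y → ℝ) (s : Equiv.Perm X × (Y → X)) :
    mcaDistortion d p w ≤ expLoss d (jointLaw p w) s := by
  rw [mcaDistortion_eq_iInf_expLoss]
  exact ciInf_le (Set.finite_range _).bddBelow s

/-! ### Concentration of the joint type -/

theorem outputLaw_empType {X Y : Type} [Fintype X] [DecidableEq X] [DecidableEq Y] {n : ℕ}
    (x : Fin n → X) (y : Fin n → Y) :
    outputLaw (empType fun i => (x i, y i)) = empType y := by
  ext b
  simp only [outputLaw, empType, ← Finset.sum_div]
  congr 1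
  rw [← Nat.cast_sum, Finset.card_eq_sum_card_fiberwise (f := x) (t := Finset.univ) (by simp)]
  congr 1
  refine Finset.sum_congr rfl fun a _ => ?_
  rw [Finset.filter_filter]
  congr 1
  ext i
  simp [and_comm]

/-- The distortion of a letter-by-letter decoder depends on the original and the received string
only through their joint type. -/
theorem ambDistortion_comp {X Y : Type} [Fintype X] [DecidableEq X] [Fintype Y] [DecidableEq Y]
    (d : X → X → ℝ) (g : Y → X) {n : ℕ} (x : Fin n → X) (y : Fin n → Y) :
    ambDistortion d (fun i => g (y i)) x
      = ⨅ τ, expLoss d (empType fun i => (x i, y i)) (τ, g) := by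
  unfold ambDistortion strDistortion expLoss
  simp_rw [sum_empType_mul]

/-- The joint type of the original `x` and the received string is close to the joint law of the
type of `x` and the channel, with a probability that tends to one uniformly in `x`. -/
theorem exists_forall_prob_far_lt {X Y : Type} [Fintype X] [DecidableEq X] [Fintype Y]
    [DecidableEq Y] {w : X → Y → ℝ} (hw : IsChannel w) {t ε : ℝ} (ht : 0 < t) (hε : 0 < ε) :
    ∃ N : ℕ, ∀ n ≥ N, 0 < n ∧ ∀ x : Fin n → X,
      ∑ y : Fin n → Y with
        t ≤ dist (empType fun i => (x i, y i)) (jointLaw (empType x) w),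
        ∏ i, w (x i) (y i) < ε := by
  obtain ⟨N, hN⟩ := exists_forall_prob_deviation_lt 1 ht
    (show 0 < ε / (Fintype.card (X × Y) + 1) by positivity)
  refine ⟨N, fun n hn => ⟨(hN n hn).1, fun x => ?_⟩⟩
  obtain ⟨hn0, hN⟩ := hN n hn
  have hn0' : (0 : ℝ) < n := by exact_mod_cast hn0
  let h : X × Y → Fin n → Y → ℝ := fun z i b => if (x i, b) = z then 1 else 0
  have hlln := fun z => hN Y (fun i => w (x i)) (fun i => hw (x i)) (h z)
    (fun i a => by simp only [h]; split_ifs <;> simp)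
  have hmean : ∀ z, ∑ i, ∑ b, w (x i) b * h z i b = n * jointLaw (empType x) w z := by
    rintro ⟨a, b⟩
    simp only [jointLaw, ← mul_assoc, ← sum_ite_eq_mul_empType hn0, Finset.sum_mul]
    refine Finset.sum_congr rfl fun i _ => ?_
    simp only [h, Prod.mk.injEq]
    by_cases hx : x i = a <;> simp [hx]
  have hsum : ∀ z (y : Fin n → Y), ∑ i, h z i (y i) = n * empType (fun i => (x i, y i)) z :=
    fun z y => sum_ite_eq_mul_empType hn0 (fun i => (x i, y i)) z
  simp only [hmean, hsum, ← mul_sub, abs_mul, abs_of_pos hn0', mul_le_mul_iff_right₀ hn0'] at hlln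
  calc _ ≤ ∑ z, ∑ y : Fin n → Y with t ≤ |empType (fun i => (x i, y i)) z -
            jointLaw (empType x) w z|, ∏ i, w (x i) (y i) := by
        simp_rw [Finset.sum_filter]
        rw [Finset.sum_comm]
        refine Finset.sum_le_sum fun y _ => ?_
        have hy : 0 ≤ ∏ i, w (x i) (y i) := Finset.prod_nonneg fun i _ => (hw _).1 _
        have hnn : ∀ z ∈ Finset.univ, 0 ≤ if t ≤ |empType (fun i => (x i, y i)) z -
            jointLaw (empType x) w z| then ∏ i, w (x i) (y i) else 0 := by
          intro z _; split_ifs <;> simp [hy]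
        split_ifs with hc
        · obtain ⟨z, hz⟩ : ∃ z, t ≤ |empType (fun i => (x i, y i)) z -
              jointLaw (empType x) w z| := by
            by_contra! hcon
            exact hc.not_gt ((dist_pi_lt_iff ht).2 hcon)
          refine le_trans ?_ (Finset.single_le_sum hnn (Finset.mem_univ z))
          simp [hz]
        · exact Finset.sum_nonneg hnn
    _ ≤ ∑ z : X × Y, ε / (Fintype.card (X × Y) + 1) :=
        Finset.sum_le_sum fun z _ => (hlln z).le
    _ < ε := by
        rw [Finset.sum_const, Finset.card_univ, nsmul_eq_mul, mul_div_assoc',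
          div_lt_iff₀ (by positivity)]
        linarith

/-! ### The universal decoder -/

theorem continuous_expLoss {X Y : Type} [Fintype X] [Fintype Y] (d : X → X → ℝ)
    (s : Equiv.Perm X × (Y → X)) : Continuous fun π => expLoss d π s := by
  unfold expLoss; fun_prop

theorem continuous_outputLaw {X Y : Type} [Fintype X] :
    Continuous (outputLaw : (X × Y → ℝ) → Y → ℝ) := by
  unfold outputLaw; fun_prop

theorem expLoss_relabel {X Y : Type} [Fintype X] [Fintype Y] (d : X → X → ℝ)
    (π : X × Y → ℝ) (σ : Equiv.Perm X) (s : Equiv.Perm X × (Y → X)) :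
    expLoss d (fun z => π (σ z.1, z.2)) (s.1 * σ, s.2) = expLoss d π s := by
  unfold expLoss
  exact Fintype.sum_equiv (σ.prodCongr (Equiv.refl Y)) _ (fun z => π z * d (s.2 z.2) (s.1 z.1))
    fun z => rfl

/-- Plug-in decoding. Let `Θ` be a compact set of joint distributions of original and received
letter, and choose the decoder `G q` to be optimal for a member of `Θ` whose output distribution
is as close to `q` as possible. On every compact `Θ₀ ⊆ Θ` whose members are determined within `Θ`
by their output distribution, up to a relabelling of the original letters, this is optimal up to
`δ` when fed with the output distribution of any `J` close enough to the true `π ∈ Θ₀`. The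
tolerance `t` does not depend on `π`; it comes from compactness, without any explicit modulus of
continuity. -/
theorem exists_plugin_decoder {X Y : Type} [Fintype X] [DecidableEq X] [Nonempty X] [Fintype Y]
    [DecidableEq Y] (d : X → X → ℝ) {Θ : Set (X × Y → ℝ)} (hΘ : IsCompact Θ) (hne : Θ.Nonempty) :
    ∃ G : (Y → ℝ) → (Y → X), ∀ Θ₀ ⊆ Θ, IsCompact Θ₀ →
      (∀ π ∈ Θ₀, ∀ π' ∈ Θ, outputLaw π' = outputLaw π →
        ∃ σ : Equiv.Perm X, π' = fun z => π (σ z.1, z.2)) →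
      ∀ δ > 0, ∃ t > 0, ∀ π ∈ Θ₀, ∀ J ∈ Set.Icc (0 : X × Y → ℝ) 1, dist J π < t →
        ⨅ τ, expLoss d J (τ, G (outputLaw J)) ≤ (⨅ s, expLoss d π s) + δ := by
  have hest : ∀ q : Y → ℝ, ∃ π ∈ Θ, ∀ π' ∈ Θ, dist (outputLaw π) q ≤ dist (outputLaw π') q := by
    intro q
    obtain ⟨π, h1, h2⟩ := hΘ.exists_isMinOn hne
      (f := fun π => dist (outputLaw π) q) (continuous_outputLaw.dist continuous_const).continuousOn
    exact ⟨π, h1, fun π' h => h2 h⟩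
  choose est hest hmin using hest
  have hopt : ∀ π : X × Y → ℝ, ∃ s, ∀ s', expLoss d π s ≤ expLoss d π s' := fun π =>
    Finite.exists_min _
  choose opt hopt using hopt
  refine ⟨fun q => (opt (est q)).2, fun Θ₀ hsub hΘ₀ hid δ hδ => ?_⟩
  -- The triples (true law, joint type, estimate) on which the decoder `s` is chosen, but is worse
  -- than `s₀` by `δ`. They form a closed set that contains no triple with `J = π`.
  let bad (s s₀ : Equiv.Perm X × (Y → X)) : Set ((X × Y → ℝ) × (X × Y → ℝ) × (X × Y → ℝ)) :=
    {v | dist (outputLaw v.2.2) (outputLaw v.2.1) ≤ dist (outputLaw v.1) (outputLaw v.2.1) ∧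
      (∀ s', expLoss d v.2.2 s ≤ expLoss d v.2.2 s') ∧
      ∀ τ, expLoss d v.1 s₀ + δ ≤ expLoss d v.2.1 (τ, s.2)}
  have hclosed : ∀ s s₀, IsClosed (bad s s₀) := by
    intro s s₀
    have hc := continuous_expLoss (X := X) (Y := Y) d
    have ho := continuous_outputLaw (X := X) (Y := Y)
    simp only [bad, Set.ofPred_and, Set.ofPred_forall]
    refine IsClosed.inter (isClosed_le (by fun_prop) (by fun_prop)) (IsClosed.inter ?_ ?_)
    · exact isClosed_iInter fun s' => isClosed_le ((hc _).comp (by fun_prop))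
        ((hc _).comp (by fun_prop))
    · exact isClosed_iInter fun τ => isClosed_le
        (((hc _).comp (by fun_prop)).add continuous_const) ((hc _).comp (by fun_prop))
  have key : ∀ s s₀, ∃ t > 0, ∀ v ∈ (Θ₀ ×ˢ Set.Icc (0 : X × Y → ℝ) 1 ×ˢ Θ) ∩ bad s s₀,
      t ≤ dist v.2.1 v.1 := by
    intro s s₀
    refine IsCompact.exists_forall_le' (f := fun v => dist v.2.1 v.1) (a := 0)
      ((hΘ₀.prod (isCompact_Icc.prod hΘ)).inter_right (hclosed s s₀))
      (Continuous.continuousOn (by fun_prop)) ?_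
    rintro ⟨π, J, π'⟩ ⟨⟨hπ, -, hπ'⟩, h1, h2, h3⟩
    refine dist_pos.2 fun heq => ?_
    simp only at heq h1 h2 h3
    subst heq
    rw [dist_self] at h1
    -- If `J = π`, the estimate is exact up to a relabelling, which does not affect optimality.
    obtain ⟨σ, rfl⟩ := hid J hπ π' hπ' (dist_le_zero.1 h1)
    have h4 := h2 (s₀.1 * σ, s₀.2)
    rw [expLoss_relabel] at h4
    have h5 := expLoss_relabel d J σ (s.1 * σ⁻¹, s.2)
    rw [inv_mul_cancel_right] at h5
    have h6 := h3 (s.1 * σ⁻¹)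
    simp only [Prod.mk.eta] at h5
    linarith
  have hev : ∀ᶠ t in nhdsWithin (0 : ℝ) (Set.Ioi 0), ∀ s s₀,
      ∀ v ∈ (Θ₀ ×ˢ Set.Icc (0 : X × Y → ℝ) 1 ×ˢ Θ) ∩ bad s s₀, t ≤ dist v.2.1 v.1 := by
    simp only [Filter.eventually_all]
    intro s s₀
    obtain ⟨t, ht, h⟩ := key s s₀
    filter_upwards [Ioo_mem_nhdsGT ht] with t' ht' v hv
    exact ht'.2.le.trans (h v hv)
  obtain ⟨t, ht, hpos⟩ := (hev.and self_mem_nhdsWithin).exists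
  refine ⟨t, hpos, fun π hπ J hJ hd => ?_⟩
  obtain ⟨s₀, hs₀⟩ := exists_eq_ciInf_of_finite (f := fun s => expLoss d π s)
  by_contra! hcon
  rw [← hs₀] at hcon
  refine hd.not_ge (ht (opt (est (outputLaw J))) s₀ (π, J, est (outputLaw J))
    ⟨⟨hπ, hJ, hest _⟩, hmin _ π (hsub hπ), hopt _, fun τ => ?_⟩)
  exact hcon.le.trans (ciInf_le (Set.finite_range _).bddBelow τ)

theorem continuous_jointLaw {X Y : Type} :
    Continuous fun v : (X → ℝ) × (X → Y → ℝ) => jointLaw v.1 v.2 := by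
  unfold jointLaw; fun_prop

theorem dist_jointLaw_le {X Y : Type} [Fintype X] [Fintype Y] {w : X → Y → ℝ} (hw : IsChannel w)
    (p p' : X → ℝ) : dist (jointLaw p w) (jointLaw p' w) ≤ ∑ a, |p a - p' a| := by
  refine (dist_pi_le_iff (Finset.sum_nonneg fun _ _ => abs_nonneg _)).2 fun z => ?_
  rw [Real.dist_eq, jointLaw, jointLaw, ← sub_mul, abs_mul, abs_of_nonneg ((hw z.1).1 z.2)]
  have h1 : w z.1 z.2 ≤ 1 := by
    rw [← (hw z.1).2]
    exact Finset.single_le_sum (fun b _ => (hw z.1).1 b) (Finset.mem_univ z.2)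
  exact (mul_le_of_le_one_right (abs_nonneg _) h1).trans
    (Finset.single_le_sum (f := fun a => |p a - p' a|) (fun a _ => abs_nonneg _)
      (Finset.mem_univ z.1))

theorem failProb_mono {X : Type} [Fintype X] {K n : ℕ} (d : X → X → ℝ)
    {W : Fin K → X → X → ℝ} (hW : ∀ j, IsChannel (W j)) (C : Algorithms X K) {D D' : ℝ}
    (h : D ≤ D') (x : Fin n → X) : failProb d W C D' x ≤ failProb d W C D x := by
  refine Finset.sum_le_sum_of_subset_of_nonneg ?_ fun y _ _ => ?_
  · exact Finset.monotone_filter_right _ fun y _ hy => h.trans_lt hy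
  · exact Finset.prod_nonneg fun i _ => (jointChannel_isChannel hW _).1 _

/-- One sequence of algorithms attains the minimal clairvoyant ambiguous distortion on all of `S`,
provided that within a compact `𝒲 ⊇ S` the output distribution determines the input distribution
and the channels, up to a relabelling of the input letters. -/
theorem exists_forall_uniformlyAchieves_mcaDistortion {X : Type} [Fintype X] [DecidableEq X]
    [Nonempty X] {K : ℕ} (d : X → X → ℝ) {𝒲 S : Set (Fin K → X → X → ℝ)} (h𝒲 : IsCompact 𝒲)
    (hS : S ⊆ 𝒲)
    (hch : ∀ W ∈ 𝒲, ∀ j, IsChannel (W j))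
    (hid : ∀ W ∈ S, ∀ W' ∈ 𝒲, ∀ p ∈ stdSimplex ℝ X, ∀ p' ∈ stdSimplex ℝ X,
      outputLaw (jointLaw p' (jointChannel W')) = outputLaw (jointLaw p (jointChannel W)) →
      ∃ σ : Equiv.Perm X, ∀ a, p' a = p (σ a) ∧ ∀ j, W' j a = W j (σ a)) :
    ∃ C : Algorithms X K, ∀ W ∈ S, ∀ δ > 0,
      UniformlyAchieves d W C fun p => mcaDistortion d p (jointChannel W) + δ := by
  have hjw : Continuous (jointChannel : (Fin K → X → X → ℝ) → X → (Fin K → X) → ℝ) := by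
    unfold jointChannel; fun_prop
  have hjc : Continuous fun v : (X → ℝ) × (Fin K → X → X → ℝ) =>
      jointLaw v.1 (jointChannel v.2) :=
    continuous_jointLaw.comp (continuous_fst.prodMk (hjw.comp continuous_snd))
  rcases S.eq_empty_or_nonempty with rfl | ⟨W₁, hW₁⟩
  · exact ⟨fun n y i => Classical.arbitrary X, by simp⟩
  obtain ⟨p₁, hp₁⟩ : (stdSimplex ℝ X).Nonempty :=
    ⟨_, single_mem_stdSimplex ℝ (Classical.arbitrary X)⟩
  obtain ⟨G, hG⟩ := exists_plugin_decoder (Y := Fin K → X) d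
    (((isCompact_stdSimplex ℝ X).prod h𝒲).image hjc) ⟨_, (p₁, W₁), ⟨hp₁, hS hW₁⟩, rfl⟩
  refine ⟨fun n y i => G (empType y) (y i), fun W hW δ hδ ε hε => ?_⟩
  have hw : IsChannel (jointChannel W) := jointChannel_isChannel (hch W (hS hW))
  obtain ⟨t, ht, hGt⟩ := hG ((fun p => jointLaw p (jointChannel W)) '' stdSimplex ℝ X)
    (by rintro _ ⟨p, hp, rfl⟩; exact ⟨(p, W), ⟨hp, hS hW⟩, rfl⟩)
    ((isCompact_stdSimplex ℝ X).image (by unfold jointLaw; fun_prop))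
    (by
      rintro _ ⟨p, hp, rfl⟩ _ ⟨⟨p', W'⟩, ⟨hp', hW'⟩, rfl⟩ h
      obtain ⟨σ, hσ⟩ := hid W hW W' hW' p hp p' hp' h
      refine ⟨σ, funext fun z => ?_⟩
      simp only [jointLaw, jointChannel, (hσ z.1).1, (hσ z.1).2]) δ hδ
  obtain ⟨N₁, hN₁⟩ := exists_forall_prob_far_lt hw (half_pos ht) hε
  obtain ⟨N₂, hN₂⟩ := exists_nat_one_div_lt (half_pos ht)
  refine ⟨max N₁ N₂, fun p hp n hn x hx => ?_⟩
  obtain ⟨hn0, hfar⟩ := hN₁ n ((le_max_left _ _).trans hn)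
  refine lt_of_le_of_lt ?_ (hfar x)
  refine Finset.sum_le_sum_of_subset_of_nonneg ?_ fun y _ _ =>
    Finset.prod_nonneg fun i _ => (hw _).1 _
  refine Finset.monotone_filter_right _ fun y _ hy => ?_
  by_contra! hcon
  refine (lt_of_lt_of_le hy ?_).false
  rw [ambDistortion_comp, ← outputLaw_empType x y]
  beta_reduce
  rw [mcaDistortion_eq_iInf_expLoss]
  refine hGt _ ⟨p, hp, rfl⟩ _ (empType_mem_Icc _) ?_
  have hN : (1 : ℝ) / ((max N₁ N₂ : ℕ) + 1) ≤ 1 / (N₂ + 1) := by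
    gcongr
    exact le_max_right _ _
  calc _ ≤ _ := dist_triangle _ (jointLaw (empType x) (jointChannel W)) _
    _ < t / 2 + t / 2 := add_lt_add hcon
      ((dist_jointLaw_le hw _ _).trans_lt ((hx.trans hN).trans_lt hN₂))
    _ = t := add_halves t

/-! ### The lower bound for all algorithms -/

/-- Disintegration: `r b` is the conditional distribution of the original letter given that `b` is
received. It is an arbitrary distribution where `b` has probability zero. -/
theorem exists_conditional {X Y : Type} [Fintype X] [Nonempty X] (π : X × Y → ℝ) (hπ : 0 ≤ π) :
    ∃ r : Y → X → ℝ, (∀ b, r b ∈ stdSimplex ℝ X) ∧ ∀ z, π z = outputLaw π z.2 * r z.2 z.1 := by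
  classical
  have hpt : ∀ b, ∃ r ∈ stdSimplex ℝ X, ∀ a, π (a, b) = outputLaw π b * r a := by
    intro b
    by_cases h : outputLaw π b = 0
    · refine ⟨_, single_mem_stdSimplex ℝ (Classical.arbitrary X), fun a => ?_⟩
      rw [h, zero_mul]
      exact (Finset.sum_eq_zero_iff_of_nonneg fun a _ => hπ (a, b)).1 h a (Finset.mem_univ a)
    · refine ⟨fun a => π (a, b) / outputLaw π b, ⟨fun a => ?_, ?_⟩, fun a => ?_⟩
      · exact div_nonneg (hπ _) (Finset.sum_nonneg fun a _ => hπ _)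
      · rw [← Finset.sum_div]
        exact div_self h
      · rw [mul_div_cancel₀ _ h]
  choose r hr h using hpt
  exact ⟨r, hr, fun z => h z.2 z.1⟩

/-- If the original and received letters are independent samples of `π`, no algorithm, with a fixed
relabelling `τ`, gets below the optimal expected loss, except with small probability. Given the
received string `y`, the original letters are still independent, so the distortion concentrates
at its conditional expectation, which is at least an average along `y` of optimal conditional
losses; that average concentrates at the optimal loss. -/
theorem exists_forall_prob_strDistortion_le_lt {X Y : Type} [Fintype X] [Nonempty X]
    [Fintype Y] (d : X → X → ℝ) {π : X × Y → ℝ} (hπ : π ∈ stdSimplex ℝ (X × Y))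
    {D ε : ℝ} (hD : ∀ s, D < expLoss d π s) (hε : 0 < ε) (τ : Equiv.Perm X) :
    ∃ N : ℕ, ∀ n ≥ N, ∀ c : (Fin n → Y) → Fin n → X,
      ∑ y : Fin n → Y, ∑ x : Fin n → X with strDistortion d (c y) (fun i => τ (x i)) ≤ D,
        ∏ i, π (x i, y i) < ε := by
  obtain ⟨r, hr, hqr⟩ := exists_conditional π hπ.1
  set q := outputLaw π with hqdef
  have hq : q ∈ stdSimplex ℝ Y := by
    refine ⟨fun b => Finset.sum_nonneg fun a _ => hπ.1 _, ?_⟩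
    rw [← hπ.2, Fintype.sum_prod_type_right]
    rfl
  obtain ⟨M, hM⟩ : ∃ M, ∀ a a', |d a a'| ≤ M := by
    obtain ⟨M, hM⟩ := (Set.finite_range fun u : X × X => |d u.1 u.2|).bddAbove
    exact ⟨M, fun a a' => hM ⟨(a, a'), rfl⟩⟩
  -- `e b c` is the conditional expected loss of the estimate `c` when `b` is received.
  let e : Y → X → ℝ := fun b c => ∑ a, r b a * d c (τ a)
  have he : ∀ b c, |e b c| ≤ M := by
    intro b c
    calc |e b c| ≤ ∑ a, |r b a * d c (τ a)| := Finset.abs_sum_le_sum_abs _ _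
      _ ≤ ∑ a, r b a * M := by
          refine Finset.sum_le_sum fun a _ => ?_
          rw [abs_mul, abs_of_nonneg ((hr b).1 a)]
          exact mul_le_mul_of_nonneg_left (hM _ _) ((hr b).1 a)
      _ = M := by rw [← Finset.sum_mul, (hr b).2, one_mul]
  have hmin : ∀ b, ∃ c, ∀ c', e b c ≤ e b c' := fun b => Finite.exists_min _
  choose g hg using hmin
  have hgD : D < ∑ b, q b * e b (g b) := by
    refine (hD (τ, g)).trans_eq ?_
    unfold expLoss
    rw [Fintype.sum_prod_type_right]
    refine Finset.sum_congr rfl fun b _ => ?_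
    rw [Finset.mul_sum]
    refine Finset.sum_congr rfl fun a _ => ?_
    rw [hqr, mul_assoc]
  obtain ⟨δ, hδ, hδD⟩ : ∃ δ > 0, D + 2 * δ ≤ ∑ b, q b * e b (g b) :=
    ⟨(∑ b, q b * e b (g b) - D) / 2, by linarith, by linarith⟩
  obtain ⟨N, hN⟩ := exists_forall_prob_deviation_lt M hδ (half_pos hε)
  refine ⟨N, fun n hn c => ?_⟩
  obtain ⟨hn0, hN⟩ := hN n hn
  have hn0' : (0 : ℝ) < n := by exact_mod_cast hn0
  have hx := fun y : Fin n → Y => hN X (fun i => r (y i)) (fun i => hr (y i))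
    (fun i a => d (c y i) (τ a)) (fun i a => hM _ _)
  have hy := hN Y (fun _ => q) (fun _ => hq) (fun _ b => e b (g b)) (fun _ b => he _ _)
  have hsplit : ∀ y : Fin n → Y,
      ∑ x : Fin n → X with strDistortion d (c y) (fun i => τ (x i)) ≤ D, ∏ i, r (y i) (x i)
      ≤ ε / 2 + if n * δ ≤ |∑ i, e (y i) (g (y i)) - ∑ i : Fin n, ∑ b, q b * e b (g b)|
        then 1 else 0 := by
    intro y
    have hnn : ∀ x : Fin n → X, 0 ≤ ∏ i, r (y i) (x i) := fun x =>
      Finset.prod_nonneg fun i _ => (hr _).1 _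
    split_ifs with hbad
    · have : ∑ x : Fin n → X with strDistortion d (c y) (fun i => τ (x i)) ≤ D,
          ∏ i, r (y i) (x i) ≤ 1 := by
        rw [← sum_prod_eq_one (P := fun i => r (y i)) fun i => hr (y i)]
        exact Finset.sum_le_sum_of_subset_of_nonneg (Finset.filter_subset _ _) fun x _ _ => hnn x
      linarith
    · rw [add_zero]
      refine le_trans ?_ (hx y).le
      refine Finset.sum_le_sum_of_subset_of_nonneg ?_ fun x _ _ => hnn x
      refine Finset.monotone_filter_right _ fun x _ hxD => ?_
      by_contra! hcon
      rw [not_le] at hbad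
      have h1 : ∑ i, d (c y i) (τ (x i)) ≤ n * D := by
        unfold strDistortion at hxD
        rwa [one_div, inv_mul_le_iff₀ hn0'] at hxD
      have h2 := (abs_lt.1 hcon).1
      have h3 := (abs_lt.1 hbad).1
      have h4 : ∑ i, e (y i) (g (y i)) ≤ ∑ i, ∑ a, r (y i) a * d (c y i) (τ a) :=
        Finset.sum_le_sum fun i _ => hg _ _
      rw [Finset.sum_const, Finset.card_univ, Fintype.card_fin, nsmul_eq_mul] at h3
      have h5 := mul_le_mul_of_nonneg_left hδD hn0'.le
      linarith
  have hqn : ∀ y : Fin n → Y, 0 ≤ ∏ i, q (y i) := fun y =>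
    Finset.prod_nonneg fun i _ => hq.1 _
  calc _ = ∑ y : Fin n → Y, (∏ i, q (y i)) *
        ∑ x : Fin n → X with strDistortion d (c y) (fun i => τ (x i)) ≤ D,
          ∏ i, r (y i) (x i) := by
        refine Finset.sum_congr rfl fun y _ => ?_
        rw [Finset.mul_sum]
        refine Finset.sum_congr rfl fun x _ => ?_
        rw [← Finset.prod_mul_distrib]
        exact Finset.prod_congr rfl fun i _ => hqr (x i, y i)
    _ ≤ ∑ y : Fin n → Y, (∏ i, q (y i)) * (ε / 2 + _) :=
        Finset.sum_le_sum fun y _ => mul_le_mul_of_nonneg_left (hsplit y) (hqn y)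
    _ = ε / 2 + _ := by
        simp_rw [mul_add, Finset.sum_add_distrib]
        rw [← Finset.sum_mul, sum_prod_eq_one (P := fun _ : Fin n => q) fun _ => hq, one_mul]
    _ < ε / 2 + ε / 2 := by
        simp only [mul_ite, mul_one, mul_zero]
        rw [← Finset.sum_filter]
        linarith
    _ = ε := add_halves ε

theorem exists_forall_prob_empType_far_lt {X : Type} [Fintype X] [DecidableEq X] {p : X → ℝ}
    (hp : p ∈ stdSimplex ℝ X) {t ε : ℝ} (ht : 0 < t) (hε : 0 < ε) :
    ∃ N : ℕ, ∀ n ≥ N, ∑ x : Fin n → X with t < ∑ a, |empType x a - p a|, ∏ i, p (x i) < ε := by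
  -- Independent sampling from `p` is sending a constant string over a channel with one input.
  obtain ⟨N, hN⟩ := exists_forall_prob_far_lt (X := Unit) (w := fun _ => p) (fun _ => hp)
    (show 0 < t / (Fintype.card X + 1) by positivity) hε
  refine ⟨N, fun n hn => ?_⟩
  obtain ⟨hn0, hN⟩ := hN n hn
  refine lt_of_le_of_lt ?_ (hN fun _ => ())
  refine Finset.sum_le_sum_of_subset_of_nonneg ?_ fun x _ _ =>
    Finset.prod_nonneg fun i _ => hp.1 _
  refine Finset.monotone_filter_right _ fun x _ hx => ?_
  by_contra! hcon
  refine hx.not_ge ?_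
  have hn0' : (n : ℝ) ≠ 0 := by positivity
  have hle : ∀ a, |empType x a - p a| ≤ t / (Fintype.card X + 1) := by
    intro a
    refine le_trans (le_of_eq ?_) ((dist_le_pi_dist _ _ ((), a)).trans hcon.le)
    simp [Real.dist_eq, empType, jointLaw, hn0']
  calc _ ≤ ∑ _ : X, t / (Fintype.card X + 1) := Finset.sum_le_sum fun a _ => hle a
    _ ≤ t := by
      rw [Finset.sum_const, Finset.card_univ, nsmul_eq_mul, mul_div_assoc',
        div_le_iff₀ (by positivity)]
      linarith

/-- The converse: even with knowledge of `p` and `W`, no resolution below the minimal clairvoyant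
ambiguous distortion is achieved. If the original is sampled independently from `p`, its type is
close to `p` with high probability, so an achieving algorithm would succeed for most samples. -/
theorem mcaDistortion_le_of_achieves {X : Type} [Fintype X] [DecidableEq X] [Nonempty X] {K : ℕ}
    (d : X → X → ℝ) {W : Fin K → X → X → ℝ} (hW : ∀ j, IsChannel (W j)) {p : X → ℝ}
    (hp : p ∈ stdSimplex ℝ X) {C : Algorithms X K} {D : ℝ} (h : Achieves d W C p D) :
    mcaDistortion d p (jointChannel W) ≤ D := by
  by_contra! hlt
  set w := jointChannel W
  have hw : IsChannel w := jointChannel_isChannel hW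
  have hπ : jointLaw p w ∈ stdSimplex ℝ (X × (Fin K → X)) := by
    refine ⟨fun z => mul_nonneg (hp.1 _) ((hw _).1 _), ?_⟩
    rw [Fintype.sum_prod_type]
    simp only [jointLaw, ← Finset.mul_sum, (hw _).2, mul_one, hp.2]
  obtain ⟨N, hN⟩ := h (1 / 4) (by norm_num)
  obtain ⟨N₁, hN₁⟩ := exists_forall_prob_empType_far_lt hp
    (show (0 : ℝ) < 1 / (N + 1) by positivity) (show (0 : ℝ) < 1 / 4 by norm_num)
  have hcard : (0 : ℝ) < Fintype.card (Equiv.Perm X) := by exact_mod_cast Fintype.card_pos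
  have hτ := fun τ => exists_forall_prob_strDistortion_le_lt d hπ
    (fun s => hlt.trans_le (mcaDistortion_le d p w s))
    (show (0 : ℝ) < 1 / (4 * Fintype.card (Equiv.Perm X)) by positivity) τ
  choose N₂ hN₂ using hτ
  obtain ⟨n, hn, hn₁, hn₂⟩ : ∃ n, N ≤ n ∧ N₁ ≤ n ∧ ∀ τ, N₂ τ ≤ n :=
    ⟨max (max N N₁) (Finset.univ.sup N₂), by omega, by omega,
      fun τ => (Finset.le_sup (Finset.mem_univ τ)).trans (le_max_right _ _)⟩
  have hprod : ∀ (x : Fin n → X) (y : Fin n → Fin K → X),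
      ∏ i, jointLaw p w (x i, y i) = (∏ i, p (x i)) * law W x y := fun x y =>
    Finset.prod_mul_distrib
  have hpn : ∀ x : Fin n → X, 0 ≤ ∏ i, p (x i) := fun x => Finset.prod_nonneg fun i _ => hp.1 _
  have hln : ∀ (x : Fin n → X) y, 0 ≤ law W x y := fun x y =>
    Finset.prod_nonneg fun i _ => (hw _).1 _
  have hl1 : ∀ x : Fin n → X, ∑ y, law W x y = 1 := fun x =>
    sum_prod_eq_one (P := fun i => w (x i)) fun i => hw _
  -- For every sample, its type is far from `p`, or the algorithm fails, or some relabelling `τ`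
  -- gives a small distortion; `hrow` is this union bound, summed over the received strings.
  have hrow : ∀ x : Fin n → X, ∏ i, p (x i) ≤
      (if 1 / ((N : ℝ) + 1) < ∑ a, |empType x a - p a| then ∏ i, p (x i) else 0)
      + (∏ i, p (x i)) * (1 / 4)
      + ∑ τ : Equiv.Perm X, ∑ y : Fin n → Fin K → X,
        if strDistortion d (C n y) (fun i => τ (x i)) ≤ D then
          ∏ i, jointLaw p w (x i, y i) else 0 := by
    intro x
    have hS : 0 ≤ ∑ τ : Equiv.Perm X, ∑ y : Fin n → Fin K → X,
        if strDistortion d (C n y) (fun i => τ (x i)) ≤ D then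
          ∏ i, jointLaw p w (x i, y i) else 0 :=
      Finset.sum_nonneg fun τ _ => Finset.sum_nonneg fun y _ => by
        split_ifs
        · rw [hprod]; exact mul_nonneg (hpn x) (hln x y)
        · exact le_rfl
    split_ifs with hfar
    · have := hpn x
      linarith
    · rw [zero_add]
      have hf := (hN n hn x (not_lt.1 hfar)).le
      calc ∏ i, p (x i) = ∑ y, (∏ i, p (x i)) * law W x y := by
            rw [← Finset.mul_sum, hl1, mul_one]
        _ ≤ ∑ y, ((∏ i, p (x i)) * (if D < ambDistortion d (C n y) x then law W x y else 0)
            + ∑ τ : Equiv.Perm X, if strDistortion d (C n y) (fun i => τ (x i)) ≤ D then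
              ∏ i, jointLaw p w (x i, y i) else 0) := by
            refine Finset.sum_le_sum fun y _ => ?_
            have hnn : ∀ τ ∈ Finset.univ, (0 : ℝ) ≤ if strDistortion d (C n y)
                (fun i => (τ : Equiv.Perm X) (x i)) ≤ D then
                ∏ i, jointLaw p w (x i, y i) else 0 := by
              intro τ _
              split_ifs
              · rw [hprod]; exact mul_nonneg (hpn x) (hln x y)
              · exact le_rfl
            split_ifs with hD
            · exact le_add_of_nonneg_right (Finset.sum_nonneg hnn)
            · rw [mul_zero, zero_add]
              obtain ⟨τ, hτ⟩ := exists_eq_ciInf_of_finite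
                (f := fun τ : Equiv.Perm X => strDistortion d (C n y) fun i => τ (x i))
              refine le_trans ?_ (Finset.single_le_sum hnn (Finset.mem_univ τ))
              rw [if_pos (hτ.trans_le (not_lt.1 hD)), hprod]
        _ = (∏ i, p (x i)) * failProb d W C D x + _ := by
            rw [Finset.sum_add_distrib, ← Finset.mul_sum, failProb, Finset.sum_filter]
        _ ≤ _ := by
            rw [Finset.sum_comm]
            exact add_le_add_left (mul_le_mul_of_nonneg_left hf (hpn x)) _
  have htot := Finset.sum_le_sum fun x (_ : x ∈ Finset.univ) => hrow x
  rw [sum_prod_eq_one (P := fun _ : Fin n => p) fun _ => hp, Finset.sum_add_distrib,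
    Finset.sum_add_distrib, ← Finset.sum_mul, sum_prod_eq_one (P := fun _ : Fin n => p) fun _ => hp,
    ← Finset.sum_filter, Finset.sum_comm] at htot
  have h3 : ∑ τ : Equiv.Perm X, ∑ x : Fin n → X, ∑ y : Fin n → Fin K → X,
      (if strDistortion d (C n y) (fun i => τ (x i)) ≤ D then
          ∏ i, jointLaw p w (x i, y i) else 0) ≤ 1 / 4 := by
    calc _ ≤ ∑ τ : Equiv.Perm X, (1 : ℝ) / (4 * Fintype.card (Equiv.Perm X)) := by
          refine Finset.sum_le_sum fun τ _ => ?_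
          have := (hN₂ τ n (hn₂ τ) (C n)).le
          rw [Finset.sum_comm]
          simpa only [Finset.sum_filter] using this
      _ = 1 / 4 := by
          rw [Finset.sum_const, Finset.card_univ, nsmul_eq_mul]
          field_simp
  have h1 := hN₁ n hn₁
  linarith

/-! ### Identifiability of binary symmetric channels -/

/-- The `K`-tuples of binary symmetric channels. -/
def bscTuples (K : ℕ) : Set (Fin K → Fin 2 → Fin 2 → ℝ) :=
  {B | ∀ j, IsChannel (B j) ∧ B j 0 0 = B j 1 1 ∧ B j 0 1 = B j 1 0}

theorem isCompact_bscTuples (K : ℕ) : IsCompact (bscTuples K) := by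
  have hc : IsCompact (Set.univ.pi fun _ : Fin K => Set.univ.pi fun _ : Fin 2 =>
      stdSimplex ℝ (Fin 2)) :=
    isCompact_univ_pi fun _ => isCompact_univ_pi fun _ => isCompact_stdSimplex ℝ (Fin 2)
  refine hc.of_isClosed_subset ?_ fun B hB j _ a _ => (hB j).1 a
  simp only [bscTuples, IsChannel, Set.ofPred_forall, Set.ofPred_and]
  refine isClosed_iInter fun j => IsClosed.inter (isClosed_iInter fun a => ?_)
    (IsClosed.inter (isClosed_eq (by fun_prop) (by fun_prop))
      (isClosed_eq (by fun_prop) (by fun_prop)))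
  exact (isClosed_stdSimplex ℝ (Fin 2)).preimage (by fun_prop)

/-- The character `0 ↦ 1`, `1 ↦ -1` of a binary letter. -/
def letterSign (a : Fin 2) : ℝ := if a = 0 then 1 else -1

/-- The bias `B(0|0) - B(1|0)` of a binary channel; that of a binary symmetric channel determines
the channel. -/
def bias (B : Fin 2 → Fin 2 → ℝ) : ℝ := B 0 0 - B 0 1

/-- The correlations of the received bits: given the original letter `a`, they are independent, and
the sign of the `j`-th has expectation `letterSign a * bias (B j)`. -/
theorem sum_outputLaw_mul_prod_letterSign {K : ℕ} {B : Fin K → Fin 2 → Fin 2 → ℝ}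
    (hB : B ∈ bscTuples K) (p : Fin 2 → ℝ) (T : Finset (Fin K)) :
    ∑ y, outputLaw (jointLaw p (jointChannel B)) y * ∏ j ∈ T, letterSign (y j)
      = ∑ a, p a * ∏ j ∈ T, (letterSign a * bias (B j)) := by
  simp only [outputLaw, jointLaw, Finset.sum_mul]
  rw [Finset.sum_comm]
  refine Finset.sum_congr rfl fun a _ => ?_
  simp only [mul_assoc, ← Finset.mul_sum]
  congr 1
  have := sum_prod_mul_prod (fun j => B j a) (fun j b => if j ∈ T then letterSign b else 1)
  simp only [Finset.prod_ite_mem, Finset.univ_inter] at this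
  rw [show (∑ y, jointChannel B a y * ∏ j ∈ T, letterSign (y j)) = _ from this,
    ← Finset.prod_subset (Finset.subset_univ T)]
  · refine Finset.prod_congr rfl fun j hj => ?_
    obtain ⟨-, h1, h2⟩ := hB j
    fin_cases a <;> simp [hj, letterSign, bias, Fin.sum_univ_two] <;> linarith
  · intro j _ hj
    simpa [hj] using ((hB j).1 a).2

/-- Three or more nonzero numbers are determined up to a common sign by their pairwise products,
as `η j ^ 2 = (η j * η k) * (η j * η l) / (η k * η l)`. This is where `3 ≤ K` is needed. -/
theorem exists_sign_of_pairwise_mul_eq {K : ℕ} (hK : 3 ≤ K) {η η' : Fin K → ℝ}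
    (hη : ∀ j, η j ≠ 0) (h : ∀ j k, j ≠ k → η' j * η' k = η j * η k) :
    (∀ j, η' j = η j) ∨ ∀ j, η' j = -η j := by
  have hsq : ∀ j, η' j ^ 2 = η j ^ 2 := by
    intro j
    obtain ⟨k, hk⟩ : ∃ k, k ∉ ({j} : Finset (Fin K)) := by
      by_contra! hcon
      have := Finset.card_le_card (fun k _ => hcon k : Finset.univ ⊆ {j})
      simp at this; omega
    obtain ⟨l, hl⟩ : ∃ l, l ∉ ({j, k} : Finset (Fin K)) := by
      by_contra! hcon
      have := (Finset.card_le_card (fun k _ => hcon k : Finset.univ ⊆ {j, k})).trans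
        Finset.card_le_two
      simp at this; omega
    simp only [Finset.mem_insert, Finset.mem_singleton, not_or] at hk hl
    have h1 := h j k (Ne.symm hk)
    have h2 := h j l (Ne.symm hl.1)
    have h3 := h k l (Ne.symm hl.2)
    have h4 : (η' j ^ 2 - η j ^ 2) * (η k * η l) = 0 := by
      linear_combination (-η' j ^ 2) * h3 + η' j * η' l * h1 + η j * η k * h2
    rcases mul_eq_zero.1 h4 with h5 | h5
    · linarith
    · exact absurd h5 (mul_ne_zero (hη k) (hη l))
  let i : Fin K := ⟨0, by omega⟩
  rcases sq_eq_sq_iff_eq_or_eq_neg.1 (hsq i) with hi | hi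
  · refine Or.inl fun j => ?_
    by_cases hj : j = i
    · rwa [hj]
    · have := h j i hj
      rw [hi] at this
      exact mul_right_cancel₀ (hη i) this
  · refine Or.inr fun j => ?_
    by_cases hj : j = i
    · rwa [hj]
    · have := h j i hj
      rw [hi] at this
      exact mul_right_cancel₀ (hη i) (by linarith)

/-- The output distribution identifies the input distribution and the channels up to a swap of the
input letters: the correlations of pairs of received bits give all biases up to a common sign, and
then the expectations of single bits give the difference of the input probabilities up to the same
sign. -/
theorem exists_perm_of_outputLaw_eq {K : ℕ} (hK : 3 ≤ K) {B B' : Fin K → Fin 2 → Fin 2 → ℝ}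
    (hB : ∀ j, B j ∈ invertibleBSC) (hB' : B' ∈ bscTuples K) {p p' : Fin 2 → ℝ}
    (hp : p ∈ stdSimplex ℝ (Fin 2)) (hp' : p' ∈ stdSimplex ℝ (Fin 2))
    (h : outputLaw (jointLaw p' (jointChannel B')) = outputLaw (jointLaw p (jointChannel B))) :
    ∃ σ : Equiv.Perm (Fin 2), ∀ a, p' a = p (σ a) ∧ ∀ j, B' j a = B j (σ a) := by
  have hBt : B ∈ bscTuples K := fun j => ⟨(hB j).1, (hB j).2.1, (hB j).2.2.1⟩
  have hs := hp.2
  have hs' := hp'.2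
  have hr := fun j => ((hB j).1 0).2
  have hr' := fun j => ((hB' j).1 0).2
  rw [Fin.sum_univ_two] at hs hs'
  simp only [Fin.sum_univ_two] at hr hr'
  have hη : ∀ j, bias (B j) ≠ 0 := by
    intro j h0
    have := hr j
    unfold bias at h0
    exact (hB j).2.2.2 (by linarith)
  have hmom : ∀ T : Finset (Fin K), ∑ a, p' a * ∏ j ∈ T, (letterSign a * bias (B' j))
      = ∑ a, p a * ∏ j ∈ T, (letterSign a * bias (B j)) := by
    intro T
    rw [← sum_outputLaw_mul_prod_letterSign hB', ← sum_outputLaw_mul_prod_letterSign hBt, h]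
  have hpair : ∀ j k, j ≠ k → bias (B' j) * bias (B' k) = bias (B j) * bias (B k) := by
    intro j k hjk
    have := hmom {j, k}
    simp only [Finset.prod_pair hjk, Fin.sum_univ_two, letterSign] at this
    simp only [if_true, one_ne_zero, if_false] at this
    linear_combination this - bias (B' j) * bias (B' k) * hs' + bias (B j) * bias (B k) * hs
  have hone : ∀ j, (p' 0 - p' 1) * bias (B' j) = (p 0 - p 1) * bias (B j) := by
    intro j
    have := hmom {j}
    simp only [Finset.prod_singleton, Fin.sum_univ_two, letterSign] at this
    simp only [if_true, one_ne_zero, if_false] at this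
    linear_combination this
  let i : Fin K := ⟨0, by omega⟩
  rcases exists_sign_of_pairwise_mul_eq hK hη hpair with hb | hb
  · have hm : p' 0 - p' 1 = p 0 - p 1 := by
      have := hone i
      rw [hb i] at this
      exact mul_right_cancel₀ (hη i) this
    refine ⟨1, fun a => ⟨?_, fun j => ?_⟩⟩
    · fin_cases a <;> simp <;> linarith
    · ext b
      have h1 := hb j
      have h2 := hr j
      have h3 := hr' j
      obtain ⟨-, h4, h5⟩ := hBt j
      obtain ⟨-, h6, h7⟩ := hB' j
      unfold bias at h1
      fin_cases a <;> fin_cases b <;> simp <;> linarith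
  · have hm : p' 0 - p' 1 = -(p 0 - p 1) := by
      have := hone i
      rw [hb i] at this
      exact mul_right_cancel₀ (hη i) (by linarith)
    refine ⟨Equiv.swap 0 1, fun a => ⟨?_, fun j => ?_⟩⟩
    · fin_cases a <;> simp <;> linarith
    · ext b
      have h1 := hb j
      have h2 := hr j
      have h3 := hr' j
      obtain ⟨-, h4, h5⟩ := hBt j
      obtain ⟨-, h6, h7⟩ := hB' j
      unfold bias at h1
      fin_cases a <;> fin_cases b <;> simp <;> linarith

/-! ### The two variants of the minimal clairvoyant ambiguous distortion -/

/-- For an invariant `d` the two variants agree: `d` is symmetric, since a transposition exchanges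
its arguments, and `τ` can be moved to the other argument, that is, to the labels. -/
theorem mcaDistortion'_eq {X Y : Type} [Fintype X] [DecidableEq X] [Fintype Y] {d : X → X → ℝ}
    (hinv : ∀ (σ : Equiv.Perm X) (x y : X), d (σ x) (σ y) = d x y) (p : X → ℝ) (w : X → Y → ℝ) :
    mcaDistortion' d p w = mcaDistortion d p w := by
  have hsymm : ∀ x y, d x y = d y x := by
    intro x y
    rw [← hinv (Equiv.swap x y) x y, Equiv.swap_apply_left, Equiv.swap_apply_right]
  unfold mcaDistortion mcaDistortion'
  congr 1
  ext s
  refine Finset.sum_congr rfl fun x _ => ?_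
  refine Fintype.sum_equiv s.1 _ _ fun x' => ?_
  rw [hsymm (s.1 x'), hinv]

theorem mcaDistortion_nonneg {X Y : Type} [Fintype X] [DecidableEq X] [Fintype Y]
    {d : X → X → ℝ} (hd : ∀ x y, 0 ≤ d x y) {p : X → ℝ} (hp : p ∈ stdSimplex ℝ X)
    {w : X → Y → ℝ} (hw : IsChannel w) : 0 ≤ mcaDistortion d p w := by
  rw [mcaDistortion_eq_iInf_expLoss]
  exact Real.iInf_nonneg fun s => Finset.sum_nonneg fun z _ =>
    mul_nonneg (mul_nonneg (hp.1 _) ((hw _).1 _)) (hd _ _)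

end Denoising

/-! ### Resolution of binary symmetric channels -/

theorem theorem4 (K : ℕ) (hK : 3 ≤ K) (d : Fin 2 → Fin 2 → ℝ) (hd : ∀ x y, 0 ≤ d x y) :
    (∀ p ∈ stdSimplex ℝ (Fin 2), ∀ B : Fin K → Fin 2 → Fin 2 → ℝ, (∀ j, B j ∈ invertibleBSC) →
      uniformResolution d p B = mcaDistortion d p (jointChannel B) ∧
      ((∀ (σ : Equiv.Perm (Fin 2)) (x y : Fin 2), d (σ x) (σ y) = d x y) →
        uniformResolution d p B = mcaDistortion' d p (jointChannel B))) ∧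
    ∃ C : Algorithms (Fin 2) K, UniformlyUniversal d invertibleBSC C := by
  obtain ⟨C, hC⟩ := exists_forall_uniformlyAchieves_mcaDistortion d
    (S := {B | ∀ j, B j ∈ invertibleBSC}) (isCompact_bscTuples K)
    (fun B hB j => ⟨(hB j).1, (hB j).2.1, (hB j).2.2.1⟩) (fun B hB j => (hB j).1)
    (fun B hB B' hB' p hp p' hp' h => exists_perm_of_outputLaw_eq hK hB hB' hp hp' h)
  refine ⟨fun p hp B hB => ?_, C, fun B hB δ hδ ε hε => ?_⟩
  · have hch : ∀ j, IsChannel (B j) := fun j => (hB j).1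
    have hmain : uniformResolution d p B = mcaDistortion d p (jointChannel B) := by
      have hmem : ∀ δ > 0, mcaDistortion d p (jointChannel B) + δ ∈
          {r : ℝ | ∃ (C : Algorithms (Fin 2) K) (D : (Fin 2 → ℝ) → ℝ),
            (∀ p' ∈ stdSimplex ℝ (Fin 2), 0 ≤ D p') ∧ UniformlyAchieves d B C D ∧ D p = r} :=
        fun δ hδ => ⟨C, _, fun p' hp' => add_nonneg
          (mcaDistortion_nonneg hd hp' (jointChannel_isChannel hch)) hδ.le, hC B hB δ hδ, rfl⟩
      refine le_antisymm (le_of_forall_pos_le_add fun δ hδ => ?_) ?_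
      · refine csInf_le ⟨0, ?_⟩ (hmem δ hδ)
        rintro _ ⟨C', D, hD, -, rfl⟩
        exact hD p hp
      · refine le_csInf ⟨_, hmem 1 one_pos⟩ ?_
        rintro _ ⟨C', D, -, hD, rfl⟩
        exact mcaDistortion_le_of_achieves d hch hp fun ε hε =>
          (hD ε hε).imp fun N hN => hN p hp
    exact ⟨hmain, fun hinv => hmain.trans (mcaDistortion'_eq hinv _ _).symm⟩
  · have hch : ∀ j, IsChannel (B j) := fun j => (hB j).1
    obtain ⟨N, hN⟩ := hC B hB δ hδ ε hε
    refine ⟨N, fun p hp n hn x hx => (failProb_mono d hch C ?_ x).trans_lt (hN p hp n hn x hx)⟩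
    have hres : mcaDistortion d p (jointChannel B) ≤ resolution d p B := by
      refine le_csInf ⟨mcaDistortion d p (jointChannel B) + 1, ?_, C, ?_⟩ ?_
      · exact add_nonneg (mcaDistortion_nonneg hd hp (jointChannel_isChannel hch)) zero_le_one
      · exact fun ε hε => (hC B hB 1 one_pos ε hε).imp fun N hN => hN p hp
      · rintro D ⟨-, C', hD⟩
        exact mcaDistortion_le_of_achieves d hch hp hD
    simpa using hres
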